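/- For positive integers $k\le N$ let $F(x)=1+\sum_{i=1}^{k}x^{n_i}$, where the exponent sequence $0<n_1<\cdots<n_k\le N$ is chosen uniformly at random among all $\binom{N}{k}$ strictly increasing sequences of $k$ integers in $\{1,\dots,N\}$. Say that $F$ has a cyclotomic factor if, for some integer $n\ge 1$, the $n$-th cyclotomic polynomial $\Phi_n(x)$ divides $F(x)$ in $\mathbb{Z}[x]$, and let $\mathbb{P}(F\text{ has a cyclotomic factor})$ be the proportion of these $\binom{N}{k}$ polynomials that have a cyclotomic factor. Then $$\lim_{k\to\infty}\ \limsup_{N\to\infty}\ \mathbb{P}\bigl(F\text{ has a cyclotomic factor}\bigr)=0.$$ -/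

import Mathlib

open Polynomial

/-- The 0,1-polynomial `1 + ∑ i ∈ S, x ^ i` with integer coefficients attached to a finite set `S`
of exponents: for `S = {n₁ < ⋯ < n_k}` it is `1 + x ^ n₁ + ⋯ + x ^ n_k`. -/
noncomputable def lacunaryPoly (S : Finset ℕ) : ℤ[X] :=
  1 + ∑ i ∈ S, X ^ i

/-- `F` is divisible by the `n`-th cyclotomic polynomial for some `n ≥ 1`
(Mathlib's `cyclotomic 0 ℤ` is the constant `1`, hence excluded). -/
def HasCyclotomicFactor (F : ℤ[X]) : Prop :=
  ∃ n : ℕ, 1 ≤ n ∧ cyclotomic n ℤ ∣ F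

/-- The possible exponent sets `{n₁ < ⋯ < n_k}` with `0 < n₁` and `n_k ≤ N`. -/
def exponentSets (k N : ℕ) : Finset (Finset ℕ) :=
  (Finset.Icc 1 N).powersetCard k

open Classical in
/-- The probability that a uniformly random `F(x) = 1 + x ^ n₁ + ⋯ + x ^ n_k` with
`0 < n₁ < ⋯ < n_k ≤ N` has a cyclotomic factor, i.e. the proportion of such polynomials
(there is at least one as soon as `k ≤ N`). -/
noncomputable def probCyclotomicFactor (k N : ℕ) : ℝ :=
  (((exponentSets k N).filter fun S => HasCyclotomicFactor (lacunaryPoly S)).card : ℝ) /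
    ((exponentSets k N).card : ℝ)

/-! If `Φ_n` divides `F` then `∑ ζ^{n_i} = -1` for a primitive `n`-th root of unity `ζ`, where `n ≥
2` because `F(1) > 0` and `n = O(N^{3/2})` because `φ(n) ≤ N`. A union bound over these `n`
suffices. For large `N`, sampling exponents with replacement costs a factor 2, leaving a walk with
`k` independent steps `ζ^t`.

For `n > T`, three steps already bound every point probability by `O(n⁻² + N⁻²)`
(`walkProb_three_le`): two unit vectors with a given nonzero sum are determined up to order. Summed
over `n`, this is `O(1/T + N^{-1/2})`. For each of the finitely many `n ≤ T`, the walk spreads out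
as `k → ∞`, uniformly in `N ≥ n` (`exists_forall_walkProb_le`). -/

open Classical in
/-- The probability that `k` independent uniform elements `t₁, …, t_k` of `s` satisfy
`z t₁ + ⋯ + z t_k = x`. -/
noncomputable def walkProb {ι G : Type*} [AddCommGroup G] (s : Finset ι) (z : ι → G) : ℕ → G → ℝ
  | 0, x => if x = 0 then 1 else 0
  | k + 1, x => (∑ t ∈ s, walkProb s z k (x - z t)) / s.card

/-! ### Point probabilities of random walks -/

section Walk

variable {ι G : Type*} [AddCommGroup G] {s : Finset ι} {z : ι → G}

lemma walkProb_succ (k : ℕ) (x : G) :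
    walkProb s z (k + 1) x = (∑ t ∈ s, walkProb s z k (x - z t)) / s.card := rfl

lemma walkProb_nonneg (k : ℕ) (x : G) : 0 ≤ walkProb s z k x := by
  induction k generalizing x with
  | zero => simp only [walkProb]; split_ifs <;> norm_num
  | succ k ih =>
    rw [walkProb_succ]
    exact div_nonneg (Finset.sum_nonneg fun t _ => ih _) (Nat.cast_nonneg _)

lemma sum_walkProb_le_one (k : ℕ) (A : Finset G) : ∑ x ∈ A, walkProb s z k x ≤ 1 := by
  classical
  induction k generalizing A with
  | zero =>
    simp only [walkProb]
    rw [Finset.sum_ite_eq']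
    split_ifs <;> norm_num
  | succ k ih =>
    simp only [walkProb_succ]
    rw [← Finset.sum_div, Finset.sum_comm]
    refine div_le_one_of_le₀ ?_ (Nat.cast_nonneg _)
    calc ∑ t ∈ s, ∑ x ∈ A, walkProb s z k (x - z t) ≤ ∑ _t ∈ s, (1 : ℝ) := by
          refine Finset.sum_le_sum fun t _ => ?_
          have h := ih (A.image fun x => x - z t)
          rwa [Finset.sum_image (fun x _ y _ h => by simpa using h)] at h
      _ = s.card := by simp

lemma walkProb_le_one (k : ℕ) (x : G) : walkProb s z k x ≤ 1 := by
  simpa using sum_walkProb_le_one (s := s) (z := z) k {x}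

lemma walkProb_succ_le {k : ℕ} {B : ℝ} (hB : 0 ≤ B) (h : ∀ x, walkProb s z k x ≤ B) (x : G) :
    walkProb s z (k + 1) x ≤ B := by
  rw [walkProb_succ]
  refine div_le_of_le_mul₀ (Nat.cast_nonneg _) hB ?_
  calc _ ≤ ∑ _t ∈ s, B := Finset.sum_le_sum fun t _ => h _
    _ = _ := by simp [mul_comm]

lemma walkProb_le_of_le {k l : ℕ} (hkl : k ≤ l) {B : ℝ} (hB : 0 ≤ B)
    (h : ∀ x, walkProb s z k x ≤ B) (x : G) : walkProb s z l x ≤ B := by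
  induction l, hkl using Nat.le_induction generalizing x with
  | base => exact h x
  | succ l _ ih => exact walkProb_succ_le hB ih x

-- Each `k`-set has `k!` orderings, which are among the `k`-tuples counted by the walk.
open Classical in
lemma factorial_mul_card_powersetCard_filter_le (k : ℕ) (x : G) :
    (k.factorial : ℝ) * ((s.powersetCard k).filter fun S => ∑ i ∈ S, z i = x).card ≤
      (s.card : ℝ) ^ k * walkProb s z k x := by
  induction k generalizing x with
  | zero =>
    simp only [walkProb, Finset.powersetCard_zero, Finset.filter_singleton, Finset.sum_empty]
    by_cases hx : x = 0
    · simp [hx]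
    · simp [hx, Ne.symm hx]
  | succ k ih =>
    rcases s.eq_empty_or_nonempty with rfl | hs
    · rw [Finset.powersetCard_eq_empty.2 (by simp)]
      simp [walkProb]
    have hs' : (s.card : ℝ) ≠ 0 := by simpa using hs.ne_empty
    -- Double counting: mark an element `t` of `S` and remove it.
    have key : (k + 1) * ((s.powersetCard (k + 1)).filter fun S => ∑ i ∈ S, z i = x).card ≤
        ∑ t ∈ s, ((s.powersetCard k).filter fun S => ∑ i ∈ S, z i = x - z t).card := by
      rw [mul_comm, ← smul_eq_mul, ← Finset.sum_const,
        ← Finset.card_sigma]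
      calc _ = ∑ S ∈ (s.powersetCard (k + 1)).filter (fun S => ∑ i ∈ S, z i = x), S.card := by
            refine Finset.sum_congr rfl fun S hS => ?_
            rw [Finset.mem_filter, Finset.mem_powersetCard] at hS
            exact hS.1.2.symm
        _ = (((s.powersetCard (k + 1)).filter (fun S => ∑ i ∈ S, z i = x)).sigma fun S => S).card :=
            (Finset.card_sigma _ _).symm
        _ ≤ _ := by
          refine Finset.card_le_card_of_injOn (fun p => ⟨p.2, p.1.erase p.2⟩) ?_ ?_
          · rintro ⟨S, t⟩ h
            simp only [Finset.coe_sigma, Set.mem_sigma_iff, Finset.mem_coe, Finset.mem_filter,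
              Finset.mem_powersetCard] at h ⊢
            obtain ⟨⟨⟨hS, hc⟩, hsum⟩, ht⟩ := h
            refine ⟨hS ht, ⟨(Finset.erase_subset _ _).trans hS, ?_⟩, ?_⟩
            · rw [Finset.card_erase_of_mem ht, hc]; rfl
            · rw [← hsum, ← Finset.sum_erase_add _ _ ht, add_sub_cancel_right]
          · rintro ⟨S, t⟩ h ⟨S', t'⟩ h' he
            simp only [Finset.coe_sigma, Set.mem_sigma_iff, Finset.mem_coe] at h h'
            simp only [Sigma.mk.injEq, heq_eq_eq] at he
            obtain ⟨rfl, he⟩ := he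
            have : S = S' := by rw [← Finset.insert_erase h.2, ← Finset.insert_erase h'.2, he]
            subst this
            rfl
    have key' : ((k : ℝ) + 1) *
        ((s.powersetCard (k + 1)).filter fun S => ∑ i ∈ S, z i = x).card ≤
        ∑ t ∈ s, (((s.powersetCard k).filter fun S => ∑ i ∈ S, z i = x - z t).card : ℝ) := by
      exact_mod_cast key
    calc _ = (k.factorial : ℝ) * (((k : ℝ) + 1) *
          ((s.powersetCard (k + 1)).filter fun S => ∑ i ∈ S, z i = x).card) := by
          rw [Nat.factorial_succ]; push_cast; ring
      _ ≤ (k.factorial : ℝ) * ∑ t ∈ s,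
          (((s.powersetCard k).filter fun S => ∑ i ∈ S, z i = x - z t).card : ℝ) := by gcongr
      _ ≤ ∑ t ∈ s, (s.card : ℝ) ^ k * walkProb s z k (x - z t) := by
          rw [Finset.mul_sum]
          exact Finset.sum_le_sum fun t _ => ih _
      _ = _ := by
          rw [walkProb_succ, ← Finset.mul_sum, pow_succ]
          field_simp

open Classical in
lemma walkProb_one (x : G) :
    walkProb s z 1 x = ((s.filter fun t => z t = x).card : ℝ) / s.card := by
  rw [walkProb_succ]
  congr 1
  simp only [walkProb, sub_eq_zero, eq_comm (a := x)]
  simp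

open Classical in
/-- If the steps hit each of `a` and `b` with probability at least `δ`, then so do the gaps
`B - walkProb` propagate along the progression from `r • a` to `r • b`. -/
lemma le_sub_walkProb_add {a b : G} {δ B : ℝ} (hδ : 0 ≤ δ) (hab : a ≠ b)
    (ha : δ * s.card ≤ ((s.filter fun t => z t = a).card : ℝ))
    (hb : δ * s.card ≤ ((s.filter fun t => z t = b).card : ℝ))
    (hs : s.Nonempty) {k : ℕ} (hB0 : 0 ≤ B)
    (hB : ∀ x, walkProb s z k x ≤ B) (r : ℕ) (x : G) :
    δ ^ r * ∑ j ∈ Finset.range (r + 1), (B - walkProb s z k (x - r • a - j • (b - a))) ≤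
      B - walkProb s z (k + r) x := by
  induction r generalizing x with
  | zero => simp
  | succ r ih =>
    have hs' : (0 : ℝ) < s.card := by exact_mod_cast hs.card_pos
    have hg : ∀ y, 0 ≤ B - walkProb s z (k + r) y := fun y =>
      sub_nonneg.2 (walkProb_le_of_le (Nat.le_add_right k r) hB0 hB y)
    have hg0 : ∀ y, 0 ≤ B - walkProb s z k y := fun y => sub_nonneg.2 (hB y)
    have h1 : δ * (B - walkProb s z (k + r) (x - a)) + δ * (B - walkProb s z (k + r) (x - b)) ≤
        B - walkProb s z (k + (r + 1)) x := by
      have e : B - walkProb s z (k + (r + 1)) x =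
          (∑ t ∈ s, (B - walkProb s z (k + r) (x - z t))) / s.card := by
        rw [← add_assoc, walkProb_succ, Finset.sum_sub_distrib]
        simp only [Finset.sum_const, nsmul_eq_mul]
        field_simp
      rw [e, le_div_iff₀ hs']
      have hd : Disjoint (s.filter fun t => z t = a) (s.filter fun t => z t = b) := by
        rw [Finset.disjoint_filter]
        rintro t _ h h'
        exact hab (h.symm.trans h')
      have hsub : (s.filter fun t => z t = a) ∪ (s.filter fun t => z t = b) ⊆ s :=
        Finset.union_subset (Finset.filter_subset _ _) (Finset.filter_subset _ _)
      refine le_trans ?_ (Finset.sum_le_sum_of_subset_of_nonneg hsub fun t _ _ => hg _)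
      rw [Finset.sum_union hd]
      have h : ∀ c, ∑ t ∈ s.filter (fun t => z t = c), (B - walkProb s z (k + r) (x - z t)) =
          ((s.filter fun t => z t = c).card : ℝ) * (B - walkProb s z (k + r) (x - c)) := by
        intro c
        rw [← nsmul_eq_mul, ← Finset.sum_const]
        refine Finset.sum_congr rfl fun t ht => ?_
        rw [(Finset.mem_filter.1 ht).2]
      rw [h a, h b]
      nlinarith [mul_le_mul_of_nonneg_right ha (hg (x - a)),
        mul_le_mul_of_nonneg_right hb (hg (x - b))]
    refine le_trans ?_ h1
    refine le_trans ?_ (add_le_add (mul_le_mul_of_nonneg_left (ih (x - a)) hδ)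
      (mul_le_mul_of_nonneg_left (ih (x - b)) hδ))
    rw [← mul_assoc, ← mul_assoc, ← pow_succ', ← mul_add]
    refine mul_le_mul_of_nonneg_left ?_ (pow_nonneg hδ _)
    -- A step `a` supplies the terms `j ≤ r`; from a step `b` only the last term is kept, as `j = r
    -- + 1`.
    rw [Finset.sum_range_succ]
    refine add_le_add (le_of_eq ?_) ?_
    · refine Finset.sum_congr rfl fun j _ => ?_
      congr 2
      rw [succ_nsmul]; abel
    · rw [Finset.sum_range_succ]
      have : x - (r + 1) • a - (r + 1) • (b - a) = x - b - r • a - r • (b - a) := by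
        rw [succ_nsmul, succ_nsmul]; abel
      rw [this]
      exact le_add_of_nonneg_left (Finset.sum_nonneg fun j _ => hg0 _)

-- The `r + 1` points of the progression are distinct, so their total mass is at most 1 and their
-- gaps below `B` sum to at least `(r + 1) * B - 1`.
open Classical in
lemma walkProb_add_le [IsAddTorsionFree G] {a b : G} {δ B : ℝ} (hδ : 0 ≤ δ) (hab : a ≠ b)
    (ha : δ * s.card ≤ ((s.filter fun t => z t = a).card : ℝ))
    (hb : δ * s.card ≤ ((s.filter fun t => z t = b).card : ℝ))
    (hs : s.Nonempty) {k : ℕ} (hB0 : 0 ≤ B)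
    (hB : ∀ x, walkProb s z k x ≤ B) (r : ℕ) (x : G) :
    walkProb s z (k + r) x ≤ B - δ ^ r * ((r + 1) * B - 1) := by
  have h := le_sub_walkProb_add hδ hab ha hb hs hB0 hB r x
  have h1 : ∑ j ∈ Finset.range (r + 1), walkProb s z k (x - r • a - j • (b - a)) ≤ 1 := by
    have h := sum_walkProb_le_one (s := s) (z := z) k
      ((Finset.range (r + 1)).image fun j : ℕ => x - r • a - j • (b - a))
    rwa [Finset.sum_image] at h
    intro i _ j _ hij
    have hij' : i • (b - a) = j • (b - a) := by simpa using hij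
    exact injective_nsmul_iff_not_isOfFinAddOrder.2
      (not_isOfFinAddOrder_of_isAddTorsionFree (sub_ne_zero.2 hab.symm)) hij'
  rw [Finset.sum_sub_distrib] at h
  simp only [Finset.sum_const, Finset.card_range, nsmul_eq_mul] at h
  push_cast at h
  have := mul_le_mul_of_nonneg_left h1 (pow_nonneg hδ r)
  linarith

end Walk

open Classical in
/-- The concentration of a walk tends to zero, uniformly in the step distribution as long as two
given points are hit with probability bounded below. -/
lemma exists_forall_walkProb_le {δ ε : ℝ} (hδ : 0 < δ) (hε : 0 < ε) :
    ∃ K : ℕ, ∀ k ≥ K, ∀ (s : Finset ℕ) (z : ℕ → ℂ) (a b : ℂ), a ≠ b → s.Nonempty →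
      δ * s.card ≤ ((s.filter fun t => z t = a).card : ℝ) →
      δ * s.card ≤ ((s.filter fun t => z t = b).card : ℝ) →
      ∀ x, walkProb s z k x ≤ ε := by
  obtain ⟨r, hr⟩ := exists_nat_ge (2 / ε)
  have hr2 : 2 ≤ (r + 1) * ε := by
    rw [div_le_iff₀ hε] at hr; linarith
  obtain ⟨J, hJ⟩ := exists_nat_ge (1 / δ ^ r)
  have hη : 0 < δ ^ r := pow_pos hδ r
  rw [div_le_iff₀ hη] at hJ
  refine ⟨J * r, fun k hk s z a b hab hs ha hb => ?_⟩
  -- As `(r + 1) * ε ≥ 2`, each block of `r` steps lowers the bound by `δ ^ r` until it reaches `ε`.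
  have key : ∀ j : ℕ, ∀ x, walkProb s z (j * r) x ≤ max ε (1 - j * δ ^ r) := by
    intro j
    induction j with
    | zero =>
      intro x
      simpa using Or.inr (walkProb_le_one (s := s) (z := z) 0 x)
    | succ j ih =>
      intro x
      rw [add_mul, one_mul]
      have h := walkProb_add_le hδ.le hab ha hb hs (le_max_of_le_left hε.le) ih r x
      have hm : ε ≤ max ε (1 - j * δ ^ r) := le_max_left _ _
      have h2 : δ ^ r ≤ δ ^ r * ((r + 1) * max ε (1 - j * δ ^ r) - 1) := by
        refine le_mul_of_one_le_right hη.le ?_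
        have : ((r : ℝ) + 1) * ε ≤ (r + 1) * max ε (1 - j * δ ^ r) := by gcongr
        linarith
      refine (h.trans (sub_le_sub_left h2 _)).trans ?_
      push_cast
      rcases le_total ε (1 - j * δ ^ r) with h3 | h3
      · rw [max_eq_right h3]
        refine le_max_of_le_right ?_
        linarith
      · rw [max_eq_left h3]
        refine le_max_of_le_left ?_
        linarith
  refine walkProb_le_of_le hk hε.le fun x => (key J x).trans ?_
  rw [max_eq_left]
  linarith

/-! ### Three steps on the unit circle -/

/-- For unit `p, q`, `p q · conj (p + q) = p + q`, so a nonzero sum determines the product, hence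
the pair. -/
lemma eq_or_eq_of_add_eq_add_of_norm_eq_one {a b u v : ℂ} (ha : ‖a‖ = 1) (hb : ‖b‖ = 1)
    (hu : ‖u‖ = 1) (hv : ‖v‖ = 1) (h : a + b = u + v) (h0 : a + b ≠ 0) : u = a ∨ u = b := by
  have hc : ∀ w : ℂ, ‖w‖ = 1 → w * (starRingEnd ℂ) w = 1 := fun w hw => by
    rw [Complex.mul_conj, Complex.normSq_eq_norm_sq, hw]; norm_num
  have hp : ∀ p q : ℂ, ‖p‖ = 1 → ‖q‖ = 1 → p * q * (starRingEnd ℂ) (p + q) = p + q := by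
    intro p q hp hq
    rw [map_add]
    linear_combination q * hc p hp + p * hc q hq
  have h0' : (starRingEnd ℂ) (a + b) ≠ 0 := by simpa only [ne_eq, map_eq_zero] using h0
  have hab : a * b = u * v := by
    refine mul_right_cancel₀ h0' ?_
    rw [hp a b ha hb, h, hp u v hu hv]
  have : (u - a) * (u - b) = 0 := by linear_combination hab - u * h
  rcases mul_eq_zero.1 this with h | h
  · exact Or.inl (sub_eq_zero.1 h)
  · exact Or.inr (sub_eq_zero.1 h)

-- Two steps reach a nonzero point with probability at most `2q²`, but for 0 only `q` is available.
-- The third step leaves 0 as the remaining target with probability at most `q`, adding `q²`.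
open Classical in
lemma walkProb_three_le {s : Finset ℕ} {z : ℕ → ℂ} (hz : ∀ t, ‖z t‖ = 1) {q : ℝ} (hq : 0 ≤ q)
    (h : ∀ w, ((s.filter fun t => z t = w).card : ℝ) ≤ q * s.card) (x : ℂ) :
    walkProb s z 3 x ≤ 3 * q ^ 2 := by
  have h1 : ∀ x, walkProb s z 1 x ≤ q := fun x => by
    rw [walkProb_one]
    exact div_le_of_le_mul₀ (Nat.cast_nonneg _) hq (h x)
  have h2 : ∀ x ≠ 0, walkProb s z 2 x ≤ 2 * q ^ 2 := by
    intro x hx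
    rw [walkProb_succ]
    refine div_le_of_le_mul₀ (Nat.cast_nonneg _) (by positivity) ?_
    by_cases hex : ∃ t ∈ s, ∃ u ∈ s, z t + z u = x
    · obtain ⟨t, ht, u, hu, rfl⟩ := hex
      have hsub : (s.filter fun i => walkProb s z 1 (z t + z u - z i) ≠ 0) ⊆
          (s.filter fun i => z i = z t) ∪ s.filter fun i => z i = z u := by
        intro i hi
        rw [Finset.mem_filter, walkProb_one] at hi
        obtain ⟨his, hi⟩ := hi
        have hne : (s.filter fun j => z j = z t + z u - z i).Nonempty := by
          rw [Finset.nonempty_iff_ne_empty]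
          intro he
          simp [he] at hi
        obtain ⟨j, hj⟩ := hne
        have hj := (Finset.mem_filter.1 hj).2
        have := eq_or_eq_of_add_eq_add_of_norm_eq_one (hz t) (hz u) (hz i) (hz j)
          (by rw [hj]; ring) hx
        simpa [his] using this
      have hcard := (Finset.card_le_card hsub).trans (Finset.card_union_le _ _)
      have hcard' : ((s.filter fun i => walkProb s z 1 (z t + z u - z i) ≠ 0).card : ℝ) ≤
          2 * (q * s.card) := by
        have : ((s.filter fun i => walkProb s z 1 (z t + z u - z i) ≠ 0).card : ℝ) ≤
          ((s.filter fun i => z i = z t).card : ℝ) + ((s.filter fun i => z i = z u).card : ℝ) := by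
          exact_mod_cast hcard
        linarith [h (z t), h (z u)]
      rw [← Finset.sum_filter_ne_zero]
      calc _ ≤ ∑ _i ∈ s.filter fun i => walkProb s z 1 (z t + z u - z i) ≠ 0, q :=
            Finset.sum_le_sum fun i _ => h1 _
        _ = ((s.filter fun i => walkProb s z 1 (z t + z u - z i) ≠ 0).card : ℝ) * q := by simp
        _ ≤ 2 * (q * s.card) * q := by gcongr
        _ = _ := by ring
    · push Not at hex
      rw [Finset.sum_eq_zero]
      · positivity
      · intro i hi
        rw [walkProb_one, Finset.filter_false_of_mem]
        · simp
        · intro j hj he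
          exact hex i hi j hj (by rw [he]; ring)
  rw [walkProb_succ]
  refine div_le_of_le_mul₀ (Nat.cast_nonneg _) (by positivity) ?_
  rw [← Finset.sum_filter_add_sum_filter_not s (fun t => z t = x)]
  have e1 : ∑ t ∈ s.filter (fun t => z t = x), walkProb s z 2 (x - z t) ≤ q * s.card * q := by
    calc _ ≤ ∑ _t ∈ s.filter (fun t => z t = x), q :=
          Finset.sum_le_sum fun t _ => walkProb_succ_le hq h1 _
      _ = ((s.filter fun t => z t = x).card : ℝ) * q := by simp
      _ ≤ _ := by gcongr; exact h x
  have e2 : ∑ t ∈ s.filter (fun t => ¬ z t = x), walkProb s z 2 (x - z t) ≤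
      s.card * (2 * q ^ 2) := by
    calc _ ≤ ∑ _t ∈ s.filter (fun t => ¬ z t = x), 2 * q ^ 2 := by
          refine Finset.sum_le_sum fun t ht => h2 _ ?_
          rw [sub_ne_zero]
          exact fun e => (Finset.mem_filter.1 ht).2 e.symm
      _ = ((s.filter fun t => ¬ z t = x).card : ℝ) * (2 * q ^ 2) := by simp
      _ ≤ _ := by gcongr; exact Finset.filter_subset _ _
  linarith

/-! ### A lower bound for the totient -/

lemma Nat.sq_le_eight_mul_totient_pow_three (n : ℕ) : n ^ 2 ≤ 8 * n.totient ^ 3 := by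
  -- `p² ≤ (p - 1)³` fails only at `p = 2, 3`; the weights 4 and 2 repair this and multiply over
  -- coprime factors.
  have key : n ^ 2 ≤ (if 2 ∣ n then 4 else 1) * (if 3 ∣ n then 2 else 1) * n.totient ^ 3 := by
    induction n using Nat.recOnPosPrimePosCoprime with
    | zero => simp
    | one => simp
    | prime_pow p a hp ha =>
      obtain ⟨a, rfl⟩ : ∃ b, a = b + 1 := ⟨a - 1, by omega⟩
      rw [Nat.totient_prime_pow hp ha, Nat.add_sub_cancel]
      have hpow : (p ^ a) ^ 2 ≤ (p ^ a) ^ 3 :=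
        Nat.pow_le_pow_right (pow_pos hp.pos a) (by norm_num)
      have h : p ^ 2 ≤ (if 2 ∣ p ^ (a + 1) then 4 else 1) * (if 3 ∣ p ^ (a + 1) then 2 else 1) *
          (p - 1) ^ 3 := by
        rcases hp.eq_two_or_odd' with rfl | hodd
        · have : 2 ∣ 2 ^ (a + 1) := dvd_pow_self 2 (by omega)
          rw [if_pos this]
          split_ifs <;> norm_num
        · by_cases h3 : p = 3
          · subst h3
            have : 3 ∣ 3 ^ (a + 1) := dvd_pow_self 3 (by omega)
            rw [if_pos this]
            split_ifs <;> norm_num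
          · have h5 : 5 ≤ p := by
              have := hp.two_le
              obtain ⟨m, rfl⟩ := hodd
              omega
            obtain ⟨m, rfl⟩ : ∃ m, p = m + 5 := ⟨p - 5, by omega⟩
            have h1 : (m + 5) ^ 2 ≤ (m + 5 - 1) ^ 3 := by
              rw [show m + 5 - 1 = m + 4 by omega]
              nlinarith [Nat.zero_le m, Nat.zero_le (m ^ 2), Nat.zero_le (m ^ 3)]
            refine h1.trans (Nat.le_mul_of_pos_left _ ?_)
            split_ifs <;> norm_num
      calc (p ^ (a + 1)) ^ 2 = (p ^ a) ^ 2 * p ^ 2 := by ring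
        _ ≤ (p ^ a) ^ 3 * _ := Nat.mul_le_mul hpow h
        _ = _ := by ring
    | coprime a b ha hb hab iha ihb =>
      rw [Nat.totient_mul hab, mul_pow]
      refine (Nat.mul_le_mul iha ihb).trans ?_
      have hc : ∀ p c : ℕ, p.Prime → (if p ∣ a then c else 1) * (if p ∣ b then c else 1) =
          if p ∣ a * b then c else 1 := by
        intro p c hp
        have hn : ¬ (p ∣ a ∧ p ∣ b) := fun h => Nat.not_coprime_of_dvd_of_dvd hp.one_lt h.1 h.2 hab
        simp only [hp.dvd_mul]
        split_ifs <;> simp_all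
      rw [← hc 2 4 Nat.prime_two, ← hc 3 2 Nat.prime_three]
      apply le_of_eq
      ring
  refine key.trans (Nat.mul_le_mul_right _ ?_)
  split_ifs <;> norm_num

/-! ### Walks with steps `ζ ^ t` -/

section Fibres

variable {ζ : ℂ} {n : ℕ}

open Classical in
lemma IsPrimitiveRoot.card_filter_pow_eq_le (hζ : IsPrimitiveRoot ζ n) (hn : 0 < n) (N : ℕ)
    (w : ℂ) : ((Finset.Icc 1 N).filter fun t => ζ ^ t = w).card ≤ N / n + 1 := by
  rw [← Finset.card_range (N / n + 1)]
  refine Finset.card_le_card_of_injOn (fun t => t / n) ?_ ?_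
  · intro t ht
    simp only [Finset.coe_filter, Finset.mem_Icc, Set.mem_ofPred_eq] at ht
    simp only [Finset.coe_range, Set.mem_Iio]
    exact Nat.lt_succ_of_le (Nat.div_le_div_right ht.1.2)
  · intro t ht u hu htu
    simp only [Finset.coe_filter, Finset.mem_Icc, Set.mem_ofPred_eq] at ht hu htu
    have hm : ∀ i, ζ ^ i = ζ ^ (i % n) := fun i => by
      conv_lhs => rw [← Nat.mod_add_div i n, pow_add, pow_mul, hζ.pow_eq_one, one_pow, mul_one]
    have : t % n = u % n := hζ.pow_inj (Nat.mod_lt _ hn) (Nat.mod_lt _ hn)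
      (by rw [← hm, ← hm, ht.2, hu.2])
    rw [← Nat.mod_add_div t n, ← Nat.mod_add_div u n, this, htu]

open Classical in
lemma IsPrimitiveRoot.le_card_filter_pow_eq (hζ : IsPrimitiveRoot ζ n) {r N : ℕ}
    (hr : 0 < r) (hrn : r ≤ n) :
    N / n ≤ ((Finset.Icc 1 N).filter fun t => ζ ^ t = ζ ^ r).card := by
  have hn : 0 < n := hr.trans_le hrn
  conv_lhs => rw [← Finset.card_range (N / n)]
  refine Finset.card_le_card_of_injOn (fun j => n * j + r) ?_ ?_
  · intro j hj
    simp only [Finset.coe_range, Set.mem_Iio] at hj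
    simp only [Finset.coe_filter, Finset.mem_Icc, Set.mem_ofPred_eq]
    refine ⟨⟨by omega, ?_⟩, ?_⟩
    · have : n * (j + 1) ≤ n * (N / n) := Nat.mul_le_mul_left n hj
      have := Nat.mul_div_le N n
      linarith
    · rw [pow_add, pow_mul, hζ.pow_eq_one, one_pow, one_mul]
  · intro i _ j _ hij
    exact Nat.eq_of_mul_eq_mul_left hn (Nat.add_right_cancel hij)

lemma IsPrimitiveRoot.walkProb_le (hζ : IsPrimitiveRoot ζ n) (hn : 0 < n) {k N : ℕ} (hk : 3 ≤ k)
    (hN : 0 < N) (x : ℂ) :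
    walkProb (Finset.Icc 1 N) (fun t => ζ ^ t) k x ≤ 6 * ((n : ℝ) ^ 2)⁻¹ + 6 * ((N : ℝ) ^ 2)⁻¹ := by
  classical
  have hn' : (0 : ℝ) < n := by exact_mod_cast hn
  have hN' : (0 : ℝ) < N := by exact_mod_cast hN
  refine walkProb_le_of_le hk (by positivity) (fun y => ?_) x
  have h := walkProb_three_le (s := Finset.Icc 1 N) (z := fun t => ζ ^ t) (fun t => by
    rw [norm_pow, hζ.norm'_eq_one hn.ne', one_pow]) (q := (n : ℝ)⁻¹ + (N : ℝ)⁻¹) (by positivity)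
    (fun w => ?_) y
  · refine h.trans ?_
    rw [← inv_pow, ← inv_pow]
    nlinarith [sq_nonneg ((n : ℝ)⁻¹ - (N : ℝ)⁻¹)]
  · have h1 : (((Finset.Icc 1 N).filter fun t => ζ ^ t = w).card : ℝ) ≤ ((N / n : ℕ) : ℝ) + 1 := by
      exact_mod_cast hζ.card_filter_pow_eq_le hn N w
    have h2 : ((N / n : ℕ) : ℝ) ≤ N / n := Nat.cast_div_le
    rw [Nat.card_Icc, Nat.add_sub_cancel, add_mul, inv_mul_cancel₀ hN'.ne', inv_mul_eq_div]
    linarith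

end Fibres

lemma exists_forall_walkProb_exp_le {n : ℕ} (hn : 2 ≤ n) {ε : ℝ} (hε : 0 < ε) :
    ∃ K : ℕ, ∀ k ≥ K, ∀ N ≥ n, ∀ ζ : ℂ, IsPrimitiveRoot ζ n → ∀ x,
      walkProb (Finset.Icc 1 N) (fun t => ζ ^ t) k x ≤ ε := by
  classical
  have hn' : (0 : ℝ) < n := by exact_mod_cast (by omega : 0 < n)
  -- For `N ≥ n`, `⌊N/n⌋ ≥ N/(2n)`; the two frequent values are 1, written `ζ ^ n` since exponents
  -- start at 1, and `ζ`.
  obtain ⟨K, hK⟩ := exists_forall_walkProb_le (δ := (2 * n : ℝ)⁻¹) (by positivity) hε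
  refine ⟨K, fun k hk N hN ζ hζ x => ?_⟩
  have hfl : (2 * n : ℝ)⁻¹ * (Finset.Icc 1 N).card ≤ ((N / n : ℕ) : ℝ) := by
    have h1 : 1 ≤ N / n := Nat.div_pos hN (by omega)
    have h2 : N ≤ 2 * n * (N / n) := by
      have := Nat.div_add_mod N n
      have := Nat.mod_lt N (by omega : n > 0)
      nlinarith
    rw [Nat.card_Icc, Nat.add_sub_cancel, inv_mul_le_iff₀ (by positivity)]
    exact_mod_cast h2
  refine hK k hk (Finset.Icc 1 N) _ (ζ ^ n) (ζ ^ 1) ?_ (Finset.nonempty_Icc.2 (by omega)) ?_ ?_ x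
  · rw [hζ.pow_eq_one, pow_one]
    exact (hζ.ne_one (by omega)).symm
  · exact hfl.trans (by exact_mod_cast hζ.le_card_filter_pow_eq (by omega) le_rfl)
  · exact hfl.trans (by exact_mod_cast hζ.le_card_filter_pow_eq one_pos (by omega))

/-! ### Union bound over cyclotomic factors -/

/-- Bernoulli: `(1 - k/N)^k ≥ 1 - k²/N ≥ 1/2`. -/
lemma Nat.pow_le_two_mul_descFactorial {k N : ℕ} (hN : 2 * k ^ 2 + k + 1 ≤ N) :
    N ^ k ≤ 2 * N.descFactorial k := by
  have hN0 : (0 : ℝ) < N := by exact_mod_cast (by omega : 0 < N)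
  have hkN : (2 : ℝ) * k ^ 2 ≤ N := by exact_mod_cast (by omega : 2 * k ^ 2 ≤ N)
  have hkN' : (k : ℝ) ≤ N := by exact_mod_cast (by omega : k ≤ N)
  have h1 : (N - k) ^ k ≤ N.descFactorial k :=
    (Nat.pow_le_pow_left (by omega) k).trans (Nat.pow_sub_le_descFactorial N k)
  have h1' : ((N : ℝ) - k) ^ k ≤ N.descFactorial k := by
    rw [← Nat.cast_sub (by omega)]
    exact_mod_cast h1
  have hb : 1 + (k : ℝ) * (-(k / N)) ≤ (1 + -((k : ℝ) / N)) ^ k :=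
    one_add_mul_le_pow (by linarith [(div_le_one hN0).2 hkN']) k
  have hh : (1 / 2 : ℝ) ≤ 1 + (k : ℝ) * (-(k / N)) := by
    have : (k : ℝ) * (k / N) ≤ 1 / 2 := by
      rw [← mul_div_assoc, div_le_iff₀ hN0]; nlinarith
    linarith
  have he : ((N : ℝ) - k) ^ k = N ^ k * (1 + -((k : ℝ) / N)) ^ k := by
    rw [← mul_pow]; congr 1; field_simp; ring
  have hp : (0 : ℝ) < (N : ℝ) ^ k := by positivity
  have : (N : ℝ) ^ k ≤ 2 * N.descFactorial k := by nlinarith [hh.trans hb]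
  exact_mod_cast this

lemma HasCyclotomicFactor.exists_sum_pow_eq {N : ℕ} {S : Finset ℕ} (hS : S ⊆ Finset.Icc 1 N)
    (h : HasCyclotomicFactor (lacunaryPoly S)) :
    ∃ n : ℕ, 2 ≤ n ∧ n ^ 2 ≤ 8 * N ^ 3 ∧
      ∑ i ∈ S, Complex.exp (2 * Real.pi * Complex.I / n) ^ i = -1 := by
  obtain ⟨n, hn, hdvd⟩ := h
  have heval : (lacunaryPoly S).eval 1 = 1 + S.card := by
    simp [lacunaryPoly, eval_finsetSum]
  have hne : lacunaryPoly S ≠ 0 := by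
    intro h0
    rw [h0, eval_zero] at heval
    omega
  have hζ := Complex.isPrimitiveRoot_exp n (by omega)
  refine ⟨n, ?_, ?_, ?_⟩
  · by_contra hlt
    obtain rfl : n = 1 := by omega
    have h1 := eval_dvd (x := (1 : ℤ)) hdvd
    rw [heval] at h1
    simp at h1
    omega
  · have hdeg := natDegree_le_of_dvd hdvd hne
    rw [natDegree_cyclotomic] at hdeg
    have hle : (lacunaryPoly S).natDegree ≤ N := by
      refine natDegree_add_le_of_degree_le (by simp) ?_
      refine natDegree_sum_le_of_forall_le _ _ fun i hi => ?_
      rw [natDegree_X_pow]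
      exact (Finset.mem_Icc.1 (hS hi)).2
    refine (Nat.sq_le_eight_mul_totient_pow_three n).trans ?_
    gcongr
    exact hdeg.trans hle
  · obtain ⟨G, hG⟩ := hdvd
    have h0 : aeval (Complex.exp (2 * Real.pi * Complex.I / n)) (lacunaryPoly S) = 0 := by
      have hr := hζ.isRoot_cyclotomic (by omega)
      rw [hG, map_mul, aeval_def, eval₂_eq_eval_map, map_cyclotomic]
      rw [IsRoot.def] at hr
      rw [hr, zero_mul]
    simp only [lacunaryPoly, map_add, map_one, map_sum, map_pow, aeval_X] at h0
    exact eq_neg_of_add_eq_zero_right h0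

lemma probCyclotomicFactor_le_sum {k N : ℕ} (hN : 2 * k ^ 2 + k + 1 ≤ N) :
    probCyclotomicFactor k N ≤ 2 * ∑ n ∈ Finset.Icc 2 (Nat.sqrt (8 * N ^ 3)),
      walkProb (Finset.Icc 1 N) (fun t => Complex.exp (2 * Real.pi * Complex.I / n) ^ t) k (-1) := by
  classical
  have hcard : (exponentSets k N).card = N.choose k := by
    rw [exponentSets, Finset.card_powersetCard, Nat.card_Icc, Nat.add_sub_cancel]
  have hpos : (0 : ℝ) < N.choose k := by
    exact_mod_cast Nat.choose_pos (by omega)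
  have hfac : (0 : ℝ) < k.factorial := by exact_mod_cast k.factorial_pos
  rw [probCyclotomicFactor, hcard, div_le_iff₀ hpos]
  set A : ℕ → Finset (Finset ℕ) := fun n => ((Finset.Icc 1 N).powersetCard k).filter fun S =>
    ∑ i ∈ S, Complex.exp (2 * Real.pi * Complex.I / n) ^ i = -1 with hA
  have hsub : ((exponentSets k N).filter fun S => HasCyclotomicFactor (lacunaryPoly S)) ⊆
      (Finset.Icc 2 (Nat.sqrt (8 * N ^ 3))).biUnion A := by
    intro S hS
    rw [Finset.mem_filter, exponentSets] at hS
    obtain ⟨n, h2, hle, hsum⟩ := hS.2.exists_sum_pow_eq (Finset.mem_powersetCard.1 hS.1).1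
    rw [Finset.mem_biUnion]
    refine ⟨n, Finset.mem_Icc.2 ⟨h2, Nat.le_sqrt'.2 hle⟩, ?_⟩
    exact Finset.mem_filter.2 ⟨hS.1, hsum⟩
  have hle : (((exponentSets k N).filter fun S => HasCyclotomicFactor (lacunaryPoly S)).card : ℝ) ≤
      ∑ n ∈ Finset.Icc 2 (Nat.sqrt (8 * N ^ 3)), ((A n).card : ℝ) := by
    exact_mod_cast (Finset.card_le_card hsub).trans Finset.card_biUnion_le
  refine hle.trans ?_
  rw [Finset.mul_sum, Finset.sum_mul]
  refine Finset.sum_le_sum fun n _ => ?_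
  have h1 := factorial_mul_card_powersetCard_filter_le (s := Finset.Icc 1 N)
    (z := fun t => Complex.exp (2 * Real.pi * Complex.I / n) ^ t) k (-1)
  rw [Nat.card_Icc, Nat.add_sub_cancel] at h1
  have h2 : (N : ℝ) ^ k ≤ 2 * (k.factorial * N.choose k) := by
    have := Nat.pow_le_two_mul_descFactorial hN
    rw [Nat.descFactorial_eq_factorial_mul_choose] at this
    exact_mod_cast this
  refine le_of_mul_le_mul_left (h1.trans ?_) hfac
  refine (mul_le_mul_of_nonneg_right h2 (walkProb_nonneg _ _)).trans (le_of_eq ?_)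
  ring

/-! ### Choice of parameters and the limit -/

lemma exists_forall_eventually_probCyclotomicFactor_le {ε : ℝ} (hε : 0 < ε) :
    ∃ K : ℕ, ∀ k ≥ K, ∀ᶠ N : ℕ in Filter.atTop, probCyclotomicFactor k N ≤ ε := by
  -- Three contributions of `ε/6`, doubled, make `ε`; the tail `6 · 2/(T + 1)` is one of them.
  obtain ⟨T, hT⟩ := exists_nat_ge (72 / ε)
  rw [div_le_iff₀ hε] at hT
  have hT0 : (0 : ℝ) < T := by
    by_contra h
    nlinarith
  have hδ : 0 < ε / (6 * T) := by positivity
  choose! K hK using fun (n : ℕ) (hn : 2 ≤ n) => exists_forall_walkProb_exp_le hn hδ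
  refine ⟨max 3 ((Finset.Icc 2 T).sup K), fun k hk => ?_⟩
  -- `10368 = 8 · 36²`, so that `L² ≤ 8N³` gives `36 L ≤ ε N²`.
  obtain ⟨M, hM⟩ := exists_nat_ge (10368 / ε ^ 2)
  filter_upwards [Filter.eventually_ge_atTop (2 * k ^ 2 + k + 1), Filter.eventually_ge_atTop M,
    Filter.eventually_ge_atTop T] with N hN1 hN2 hN3
  have hN0 : 0 < N := by omega
  have hN0' : (0 : ℝ) < N := by exact_mod_cast hN0
  refine (probCyclotomicFactor_le_sum hN1).trans ?_
  set L := Nat.sqrt (8 * N ^ 3) with hL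
  set w : ℕ → ℝ := fun n => walkProb (Finset.Icc 1 N)
    (fun t => Complex.exp (2 * Real.pi * Complex.I / n) ^ t) k (-1) with hw
  have hw0 : ∀ n, 0 ≤ w n := fun n => walkProb_nonneg _ _
  have hsmall : ∑ n ∈ Finset.Icc 2 T, w n ≤ ε / 6 := by
    calc _ ≤ ∑ _n ∈ Finset.Icc 2 T, ε / (6 * T) := by
          refine Finset.sum_le_sum fun n hn => ?_
          have hn' := Finset.mem_Icc.1 hn
          exact hK n hn'.1 k ((Finset.le_sup hn).trans ((le_max_right _ _).trans hk)) N
            (hn'.2.trans hN3) _ (Complex.isPrimitiveRoot_exp n (by omega)) _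
      _ ≤ T * (ε / (6 * T)) := by
          rw [Finset.sum_const, nsmul_eq_mul, Nat.card_Icc]
          gcongr
          omega
      _ = ε / 6 := by field_simp
  have hlarge : ∑ n ∈ Finset.Ioo T (L + 1), w n ≤ ε / 6 + ε / 6 := by
    calc _ ≤ ∑ n ∈ Finset.Ioo T (L + 1), (6 * ((n : ℝ) ^ 2)⁻¹ + 6 * ((N : ℝ) ^ 2)⁻¹) := by
          refine Finset.sum_le_sum fun n hn => ?_
          have hn' : 0 < n := by have := (Finset.mem_Ioo.1 hn).1; omega
          exact (Complex.isPrimitiveRoot_exp n hn'.ne').walkProb_le hn'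
            ((le_max_left _ _).trans hk) hN0 _
      _ = 6 * ∑ n ∈ Finset.Ioo T (L + 1), ((n : ℝ) ^ 2)⁻¹ +
          (Finset.Ioo T (L + 1)).card * (6 * ((N : ℝ) ^ 2)⁻¹) := by
          rw [Finset.sum_add_distrib, Finset.mul_sum, Finset.sum_const, nsmul_eq_mul]
      _ ≤ ε / 6 + ε / 6 := by
          refine add_le_add ?_ ?_
          · have h := sum_Ioo_inv_sq_le (α := ℝ) T (L + 1)
            have h2 : 6 * (2 / ((T : ℝ) + 1)) ≤ ε / 6 := by
              rw [← mul_div_assoc, div_le_iff₀ (by positivity)]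
              nlinarith
            linarith
          · have hc : ((Finset.Ioo T (L + 1)).card : ℝ) ≤ L := by
              rw [Nat.card_Ioo]
              exact_mod_cast (by omega : L + 1 - T - 1 ≤ L)
            have hL2 : (L : ℝ) ^ 2 ≤ 8 * N ^ 3 := by exact_mod_cast Nat.sqrt_le' (8 * N ^ 3)
            have hNε : 10368 ≤ N * ε ^ 2 := by
              rw [div_le_iff₀ (by positivity)] at hM
              refine hM.trans ?_
              gcongr
            have hLN : 36 * (L : ℝ) ≤ ε * N ^ 2 := by
              refine le_of_sq_le_sq ?_ (by positivity)
              have : (N : ℝ) ^ 3 * 10368 ≤ N ^ 3 * (N * ε ^ 2) := by gcongr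
              nlinarith
            calc _ ≤ (L : ℝ) * (6 * ((N : ℝ) ^ 2)⁻¹) := by gcongr
              _ = 6 * L / N ^ 2 := by ring
              _ ≤ ε / 6 := by
                rw [div_le_iff₀ (by positivity)]
                linarith
  have hsplit : ∑ n ∈ Finset.Icc 2 L, w n ≤
      ∑ n ∈ Finset.Icc 2 T, w n + ∑ n ∈ Finset.Ioo T (L + 1), w n := by
    rw [← Finset.sum_union]
    · refine Finset.sum_le_sum_of_subset_of_nonneg (fun n hn => ?_) fun n _ _ => hw0 n
      simp only [Finset.mem_union, Finset.mem_Icc, Finset.mem_Ioo] at hn ⊢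
      omega
    · rw [Finset.disjoint_left]
      intro n hn hn'
      simp only [Finset.mem_Icc, Finset.mem_Ioo] at hn hn'
      omega
  linarith

lemma probCyclotomicFactor_nonneg (k N : ℕ) : 0 ≤ probCyclotomicFactor k N :=
  div_nonneg (Nat.cast_nonneg _) (Nat.cast_nonneg _)

open Classical in
lemma probCyclotomicFactor_le_one (k N : ℕ) : probCyclotomicFactor k N ≤ 1 :=
  div_le_one_of_le₀ (Nat.cast_le.2 (Finset.card_filter_le _ _)) (Nat.cast_nonneg _)

theorem theorem2 :
    Filter.Tendsto
      (fun k : ℕ => Filter.limsup (fun N : ℕ => probCyclotomicFactor k N) Filter.atTop)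
      Filter.atTop (nhds 0) := by
  -- A real `limsup` is controlled by inequalities only under boundedness.
  have hbdd : ∀ k, Filter.IsBoundedUnder (· ≤ ·) Filter.atTop fun N => probCyclotomicFactor k N :=
    fun k => Filter.isBoundedUnder_of ⟨1, fun N => probCyclotomicFactor_le_one k N⟩
  have hcobdd : ∀ k, Filter.IsCoboundedUnder (· ≤ ·) Filter.atTop
      fun N => probCyclotomicFactor k N := fun k =>
    (Filter.isBoundedUnder_of ⟨0, fun N => probCyclotomicFactor_nonneg k N⟩).isCoboundedUnder_le
  rw [Metric.tendsto_atTop]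
  intro ε hε
  obtain ⟨K, hK⟩ := exists_forall_eventually_probCyclotomicFactor_le (half_pos hε)
  refine ⟨K, fun k hk => ?_⟩
  have h1 := Filter.limsup_le_of_le (hcobdd k) (hK k hk)
  have h0 : 0 ≤ Filter.limsup (fun N : ℕ => probCyclotomicFactor k N) Filter.atTop :=
    Filter.le_limsup_of_frequently_le
      (Filter.Frequently.of_forall fun N => probCyclotomicFactor_nonneg k N) (hbdd k)
  rw [Real.dist_eq, sub_zero, abs_of_nonneg h0]
  linarith
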